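/- For every integer $N \ge 1$ there exists a constant $C = C(N)$, depending only on $N$, such that for every $1 \le p < \infty$ and every real-valued $u \in C_c^\infty(\mathbb{R}^N)$, $$\left[\frac{u(x)-u(y)}{|x-y|^{\frac{N+1}{p}}}\right]_{M^p(\mathbb{R}^N\times\mathbb{R}^N)} \le C\,\|u\|_{L^\infty(\mathbb{R}^N)}^{1-1/p}\,\|\nabla u\|_{L^1(\mathbb{R}^N)}^{1/p},$$ where $|\cdot|$ is the Euclidean norm, $0^0 = 1$, and, for a measurable function $f$ on $\mathbb{R}^N\times\mathbb{R}^N$, the Marcinkiewicz (weak $L^p$) quasinorm is $$[f]_{M^p(\mathbb{R}^N\times\mathbb{R}^N)} = \Bigl(\sup_{\lambda>0} \lambda^p\,\mathcal{L}^{2N}\bigl(\{(x,y)\in\mathbb{R}^N\times\mathbb{R}^N : |f(x,y)|\ge\lambda\}\bigr)\Bigr)^{1/p},$$ with $\mathcal{L}^{2N}$ the Lebesgue measure on $\mathbb{R}^N \times \mathbb{R}^N$. -/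

import Mathlib

open MeasureTheory
open scoped ENNReal NNReal

/-- The Marcinkiewicz (weak `L^p`) quasinorm
`(sup_{t > 0} t ^ p * μ {z : |f z| ≥ t}) ^ (1 / p)`, as an extended nonnegative number.
It is finite exactly when `f` (measurable) lies in `M^p`. -/
noncomputable def marcinkiewiczQuasinorm {X : Type*} [MeasurableSpace X]
    (f : X → ℝ) (p : ℝ) (μ : Measure X) : ℝ≥0∞ :=
  (⨆ (t : ℝ) (_ : 0 < t), ENNReal.ofReal (t ^ p) * μ {z | t ≤ |f z|}) ^ (1 / p)

/-! The heart is the case `p = 1`: the pairs with `|u x - u y| ≥ t * ‖x - y‖ ^ (N + 1)` have measure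
at most `C / t` times the `L¹` norm of the gradient. Put `y = x + r • θ` and `N = n + 1`. On a line,
such a pair is an interval of length `r` carrying mass at least `t * r ^ (n + 2)` of the derivative.
Vitali selects disjoint intervals; the parameters absorbed by one of them fill a box of area `(5r)²`
with weight at most `(5r) ^ n`, so each box costs at most `5 ^ (n + 2)` times the mass on its
interval, and disjoint masses add up. Fubini over parallel lines, then over directions in an
annulus, gives the estimate on the whole space. For general `p`, `|u x - u y| ≤ 2‖u‖_∞` turns level
`t` into level `t ^ p / (2‖u‖_∞) ^ (p - 1)` for exponent `1`. -/

/-! ### Covering argument on a line -/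

/-- One-dimensional weak-type estimate, by the Vitali covering lemma: a bounded family of intervals
`[s, s + r]` on which `f` has mass at least `a * r ^ (n + 2)` has controlled `r ^ n ds dr` measure. -/
theorem mul_setLIntegral_pow_le_of_le_setLIntegral_Icc {n : ℕ} {f : ℝ → ℝ≥0∞}
    {a : ℝ≥0∞} {R : ℝ} {E : Set (ℝ × ℝ)}
    (h0 : ∀ z ∈ E, 0 < z.2) (hR : ∀ z ∈ E, z.2 ≤ R)
    (hfE : ∀ z ∈ E, a * ENNReal.ofReal (z.2 ^ (n + 2)) ≤ ∫⁻ x in Set.Icc z.1 (z.1 + z.2), f x) :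
    a * ∫⁻ z in E, ENNReal.ofReal (z.2 ^ n) ≤ 5 ^ (n + 2) * ∫⁻ x, f x := by
  obtain ⟨v, hvE, hdisj, hcov⟩ := Vitali.exists_disjoint_subfamily_covering_enlargement_closedBall
    E (fun z => z.1 + z.2 / 2) (fun z => z.2 / 2) (R / 2) (fun z hz => by linarith [hR z hz]) 5
    (by norm_num)
  have hball (z : ℝ × ℝ) : Metric.closedBall (z.1 + z.2 / 2) (z.2 / 2)
      = Set.Icc z.1 (z.1 + z.2) := by
    rw [Real.closedBall_eq_Icc]; congr 1 <;> ring
  have hvc : v.Countable := hdisj.countable_of_nonempty_interior fun z hz => by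
    have := h0 z (hvE hz)
    rw [hball, interior_Icc, Set.nonempty_Ioo]; linarith
  have : Countable v := hvc.to_subtype
  -- An interval inside the 5-fold enlargement of `z`'s interval starts in that enlargement and has
  -- length at most `5 * z.2`.
  let B (z : ℝ × ℝ) : Set (ℝ × ℝ) :=
    Metric.closedBall (z.1 + z.2 / 2) (5 * (z.2 / 2)) ×ˢ Set.Ioc 0 (5 * z.2)
  have hsub : E ⊆ ⋃ z : v, B z := by
    intro z hz
    obtain ⟨b, hb, hzb⟩ := hcov z hz
    have hz0 := h0 z hz
    have hb0 := h0 b (hvE hb)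
    rw [hball, Real.closedBall_eq_Icc, Set.Icc_subset_Icc_iff (by linarith)] at hzb
    refine Set.mem_iUnion.2 ⟨⟨b, hb⟩, ?_, hz0, by linarith [hzb.1, hzb.2]⟩
    rw [Real.closedBall_eq_Icc]
    exact ⟨hzb.1, by linarith [hzb.2]⟩
  have hB (z : ℝ × ℝ) (hz : z ∈ E) : a * ∫⁻ w in B z, ENNReal.ofReal (w.2 ^ n)
      ≤ 5 ^ (n + 2) * ∫⁻ x in Set.Icc z.1 (z.1 + z.2), f x := by
    have hz0 := h0 z hz
    calc a * ∫⁻ w in B z, ENNReal.ofReal (w.2 ^ n)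
        ≤ a * ∫⁻ w in B z, ENNReal.ofReal ((5 * z.2) ^ n) := by
          gcongr a * ?_
          refine setLIntegral_mono measurable_const fun w hw => ?_
          exact ENNReal.ofReal_le_ofReal (pow_le_pow_left₀ hw.2.1.le hw.2.2 n)
      _ = a * ENNReal.ofReal ((5 * z.2) ^ n * (5 * z.2) * (5 * z.2)) := by
          rw [setLIntegral_const, Measure.volume_eq_prod, Measure.prod_prod, Real.volume_closedBall,
            Real.volume_Ioc, show 2 * (5 * (z.2 / 2)) = 5 * z.2 by ring, sub_zero, ← mul_assoc,
            ENNReal.ofReal_mul (p := (5 * z.2) ^ n * (5 * z.2)) (by positivity),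
            ENNReal.ofReal_mul (p := (5 * z.2) ^ n) (by positivity)]
          simp only [mul_assoc]
      _ = 5 ^ (n + 2) * (a * ENNReal.ofReal (z.2 ^ (n + 2))) := by
          rw [show (5 * z.2) ^ n * (5 * z.2) * (5 * z.2) = 5 ^ (n + 2) * z.2 ^ (n + 2) by ring,
            ENNReal.ofReal_mul (by positivity), ENNReal.ofReal_pow (by norm_num : (0:ℝ) ≤ 5)]
          norm_num
          ring
      _ ≤ _ := by gcongr; exact hfE z hz
  calc a * ∫⁻ z in E, ENNReal.ofReal (z.2 ^ n)
      ≤ a * ∑' z : v, ∫⁻ w in B z, ENNReal.ofReal (w.2 ^ n) := by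
        gcongr
        exact (lintegral_mono_set hsub).trans (lintegral_iUnion_le _ _)
    _ = ∑' z : v, a * ∫⁻ w in B z, ENNReal.ofReal (w.2 ^ n) := ENNReal.tsum_mul_left.symm
    _ ≤ ∑' z : v, 5 ^ (n + 2) * ∫⁻ x in Set.Icc z.1.1 (z.1.1 + z.1.2), f x :=
        ENNReal.tsum_le_tsum fun z => hB z (hvE z.2)
    _ = 5 ^ (n + 2) * ∫⁻ x in ⋃ z : v, Set.Icc z.1.1 (z.1.1 + z.1.2), f x := by
        rw [ENNReal.tsum_mul_left, lintegral_iUnion (fun _ => measurableSet_Icc)]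
        intro z w hzw
        have := hdisj z.2 w.2 (Subtype.coe_injective.ne hzw)
        simpa only [Function.onFun, hball] using this
    _ ≤ _ := by gcongr; exact Measure.restrict_le_self


/-- The one-dimensional weak-type estimate for the restriction of `u` to the line `s ↦ x + s • θ`. -/
theorem ofReal_mul_setLIntegral_line_le {E : Type*} [NormedAddCommGroup E] [NormedSpace ℝ E]
    {u : E → ℝ} (hu : ContDiff ℝ 1 u) (x θ : E)
    {n : ℕ} {t R : ℝ} :
    ENNReal.ofReal t * ∫⁻ z in {z : ℝ × ℝ | z.1 ∈ Set.Icc 0 R ∧ z.2 ∈ Set.Ioc 0 R ∧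
        t * z.2 ^ (n + 2) ≤ |u (x + (z.1 + z.2) • θ) - u (x + z.1 • θ)|}, ENNReal.ofReal (z.2 ^ n)
      ≤ 5 ^ (n + 2) * ∫⁻ s in Set.Icc 0 (2 * R), ‖fderiv ℝ u (x + s • θ)‖ₑ * ‖θ‖ₑ := by
  rw [← lintegral_indicator measurableSet_Icc]
  refine mul_setLIntegral_pow_le_of_le_setLIntegral_Icc (R := R) ?_ ?_ ?_
  · exact fun z hz => hz.2.1.1
  · exact fun z hz => hz.2.1.2
  · rintro ⟨s, r⟩ ⟨hs, hr, h⟩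
    dsimp only at hs hr h ⊢
    have hφ : ∀ τ, HasDerivAt (fun τ : ℝ => u (x + τ • θ)) (fderiv ℝ u (x + τ • θ) θ) τ := by
      intro τ
      have h1 : HasDerivAt (fun τ : ℝ => x + τ • θ) θ τ := by
        simpa using ((hasDerivAt_id τ).smul_const θ).const_add x
      exact ((hu.differentiable (by simp)) _).hasFDerivAt.comp_hasDerivAt τ h1
    have hφc : ContDiff ℝ 1 (fun τ : ℝ => u (x + τ • θ)) := by fun_prop
    calc ENNReal.ofReal t * ENNReal.ofReal (r ^ (n + 2))
        = ENNReal.ofReal (t * r ^ (n + 2)) := by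
          rw [ENNReal.ofReal_mul' (pow_nonneg hr.1.le _)]
      _ ≤ ‖u (x + (s + r) • θ) - u (x + s • θ)‖ₑ := by
          rw [Real.enorm_eq_ofReal_abs]; exact ENNReal.ofReal_le_ofReal h
      _ ≤ ∫⁻ τ in Set.Icc s (s + r), ‖deriv (fun τ : ℝ => u (x + τ • θ)) τ‖ₑ :=
          enorm_sub_le_lintegral_deriv_of_contDiffOn_Icc hφc.contDiffOn (by linarith [hr.1])
      _ ≤ _ := by
          refine setLIntegral_mono' measurableSet_Icc fun τ hτ => ?_
          have hmem : τ ∈ Set.Icc 0 (2 * R) :=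
            ⟨by linarith [hs.1, hτ.1], by linarith [hs.2, hτ.2, hr.2]⟩
          rw [Set.indicator_of_mem hmem, (hφ τ).deriv]
          exact ContinuousLinearMap.le_opENorm _ _

/-! ### Integration over parallel lines -/

/-- The weak-type estimate for difference quotients along a fixed direction `θ`. -/
theorem lintegral_measure_direction_le {E : Type*} [NormedAddCommGroup E]
    [NormedSpace ℝ E] [MeasurableSpace E] [BorelSpace E] [FiniteDimensional ℝ E]
    (μ : Measure E) [μ.IsAddHaarMeasure]
    {u : E → ℝ} (hu : ContDiff ℝ 1 u) {M : ℝ} (hM : ∀ x, |u x| ≤ M) (θ : E) {n : ℕ}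
    {t : ℝ} (ht : 0 < t) :
    ENNReal.ofReal t * ∫⁻ r in Set.Ioi (0 : ℝ), ENNReal.ofReal (r ^ n) *
        μ {x | t * r ^ (n + 2) ≤ |u (x + r • θ) - u x|}
      ≤ 2 * 5 ^ (n + 2) * ‖θ‖ₑ * ∫⁻ x, ‖fderiv ℝ u x‖ₑ ∂μ := by
  have hc := hu.continuous
  have hd : Continuous (fderiv ℝ u) := hu.continuous_fderiv (by simp)
  -- Boundedness of `u` caps the admissible lengths: for `r ≥ 1`, `t * r ≤ t * r ^ (n + 2) ≤ 2 * M`.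
  -- Vitali needs such a cap.
  let R : ℝ := max 1 (2 * M / t)
  have hR1 : 1 ≤ R := le_max_left _ _
  have hR : ∀ r : ℝ, ∀ x, 0 < r → t * r ^ (n + 2) ≤ |u (x + r • θ) - u x| → r ≤ R := by
    intro r x hr h
    by_contra! hlt
    have h1 : 1 ≤ r := hR1.trans hlt.le
    have h2 : 2 * M / t < r := (le_max_right _ _).trans_lt hlt
    rw [div_lt_iff₀ ht] at h2
    have h3 : r ≤ r ^ (n + 2) := le_self_pow₀ h1 (by omega)
    have h4 := abs_sub (u (x + r • θ)) (u x)
    nlinarith [hM (x + r • θ), hM x]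
  let S : Set (E × (ℝ × ℝ)) := {w | w.2.1 ∈ Set.Icc 0 R ∧ w.2.2 ∈ Set.Ioc 0 R ∧
    t * w.2.2 ^ (n + 2) ≤ |u (w.1 + (w.2.1 + w.2.2) • θ) - u (w.1 + w.2.1 • θ)|}
  have hS : MeasurableSet S := by
    refine ((measurable_fst.comp measurable_snd) measurableSet_Icc).inter
      (((measurable_snd.comp measurable_snd) measurableSet_Ioc).inter ?_)
    exact (isClosed_le (f := fun w : E × (ℝ × ℝ) => t * w.2.2 ^ (n + 2))
      (g := fun w : E × (ℝ × ℝ) => |u (w.1 + (w.2.1 + w.2.2) • θ) - u (w.1 + w.2.1 • θ)|)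
      (by fun_prop) (by fun_prop)).measurableSet
  let k : E × (ℝ × ℝ) → ℝ≥0∞ := S.indicator fun w => ENNReal.ofReal (w.2.2 ^ n)
  have hk : Measurable k := Measurable.indicator (by fun_prop) hS
  let A : ℝ → ℝ≥0∞ := fun r => ENNReal.ofReal (r ^ n) *
        μ {x | t * r ^ (n + 2) ≤ |u (x + r • θ) - u x|}
  have hslice (s : ℝ) (hs : s ∈ Set.Icc 0 R) (r : ℝ) :
      ∫⁻ x, k (x, (s, r)) ∂μ = (Set.Ioc 0 R).indicator A r := by
    by_cases hr : r ∈ Set.Ioc 0 R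
    · rw [Set.indicator_of_mem hr]
      have : ∀ x, k (x, (s, r)) = {x | t * r ^ (n + 2) ≤ |u (x + r • θ) - u x|}.indicator
          (fun _ => ENNReal.ofReal (r ^ n)) (x + s • θ) := by
        intro x
        simp only [k, S, Set.indicator, Set.mem_ofPred_eq, hs, hr, true_and, add_smul, add_assoc]
      simp_rw [this]
      rw [lintegral_add_right_eq_self (μ := μ), lintegral_indicator_const]
      exact (isClosed_le (by fun_prop) (by fun_prop)).measurableSet
    · rw [Set.indicator_of_notMem hr]
      have : ∀ x, k (x, (s, r)) = 0 := fun x => Set.indicator_of_notMem (fun h => hr h.2.1) _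
      simp [this]
  have hA : ∫⁻ r in Set.Ioi (0 : ℝ), A r = ∫⁻ r, (Set.Ioc 0 R).indicator A r := by
    rw [← lintegral_indicator measurableSet_Ioi]
    refine lintegral_congr fun r => ?_
    by_cases hr0 : 0 < r
    · rw [Set.indicator_of_mem (Set.mem_Ioi.2 hr0)]
      by_cases hr : r ≤ R
      · rw [Set.indicator_of_mem (Set.mem_Ioc.2 ⟨hr0, hr⟩)]
      · rw [Set.indicator_of_notMem (fun h => hr h.2)]
        have : {x | t * r ^ (n + 2) ≤ |u (x + r • θ) - u x|} = ∅ :=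
          Set.eq_empty_of_forall_notMem fun x hx => hr (hR r x hr0 hx)
        simp [A, this]
    · rw [Set.indicator_of_notMem (by simpa using hr0), Set.indicator_of_notMem (fun h => hr0 h.1)]
  -- By translation invariance each start `s ∈ [0, R]` contributes equally, giving the factor `R`;
  -- the intervals lie in `[0, 2 * R]`. Cancelling `R` leaves the factor `2`.
  have hkey : ENNReal.ofReal R * (ENNReal.ofReal t * ∫⁻ r in Set.Ioi (0 : ℝ), A r) ≤
      ENNReal.ofReal R * (2 * 5 ^ (n + 2) * ‖θ‖ₑ * ∫⁻ x, ‖fderiv ℝ u x‖ₑ ∂μ) := by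
    calc ENNReal.ofReal R * (ENNReal.ofReal t * ∫⁻ r in Set.Ioi (0 : ℝ), A r)
        = ENNReal.ofReal t * ∫⁻ _ in Set.Icc 0 R, (∫⁻ r in Set.Ioi (0 : ℝ), A r) := by
          rw [setLIntegral_const, Real.volume_Icc, sub_zero]; ring
      _ = ENNReal.ofReal t * ∫⁻ s in Set.Icc 0 R, ∫⁻ r, ∫⁻ x, k (x, (s, r)) ∂μ := by
          congr 1
          refine setLIntegral_congr_fun measurableSet_Icc fun s hs => ?_
          simp only [hslice s hs, hA]
      _ ≤ ENNReal.ofReal t * ∫⁻ s, ∫⁻ r, ∫⁻ x, k (x, (s, r)) ∂μ := by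
          gcongr; exact Measure.restrict_le_self
      _ = ENNReal.ofReal t * ∫⁻ x, (∫⁻ z, k (x, z)) ∂μ := by
          rw [lintegral_lintegral_swap (f := fun x z => k (x, z)) hk.aemeasurable,
            Measure.volume_eq_prod, lintegral_prod]
          exact hk.lintegral_prod_left'.aemeasurable
      _ = ∫⁻ x, ENNReal.ofReal t * (∫⁻ z, k (x, z)) ∂μ :=
          (lintegral_const_mul _ hk.lintegral_prod_right').symm
      _ ≤ ∫⁻ x, 5 ^ (n + 2) * (∫⁻ s in Set.Icc 0 (2 * R), ‖fderiv ℝ u (x + s • θ)‖ₑ * ‖θ‖ₑ) ∂μ := by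
          refine lintegral_mono fun x => ?_
          have hx : ∫⁻ z, k (x, z) = ∫⁻ z in Prod.mk x ⁻¹' S, ENNReal.ofReal (z.2 ^ n) :=
            lintegral_indicator (measurable_prodMk_left hS) (fun z => ENNReal.ofReal (z.2 ^ n))
          exact hx ▸ ofReal_mul_setLIntegral_line_le hu x θ
      _ = 5 ^ (n + 2) * ∫⁻ s in Set.Icc 0 (2 * R), ∫⁻ x, ‖fderiv ℝ u (x + s • θ)‖ₑ * ‖θ‖ₑ ∂μ := by
          have hm : Measurable (fun z : E × ℝ => ‖fderiv ℝ u (z.1 + z.2 • θ)‖ₑ * ‖θ‖ₑ) := by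
            have : Continuous (fun z : E × ℝ => fderiv ℝ u (z.1 + z.2 • θ)) := by fun_prop
            exact this.enorm.measurable.mul_const _
          rw [lintegral_const_mul _ hm.lintegral_prod_right', lintegral_lintegral_swap]
          exact hm.aemeasurable
      _ = 5 ^ (n + 2) * ∫⁻ s in Set.Icc 0 (2 * R), ‖θ‖ₑ * ∫⁻ x, ‖fderiv ℝ u x‖ₑ ∂μ := by
          congr 2 with s
          rw [lintegral_mul_const _ (by fun_prop),
            lintegral_add_right_eq_self (fun x => ‖fderiv ℝ u x‖ₑ) (μ := μ), mul_comm]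
      _ = _ := by
          rw [setLIntegral_const, Real.volume_Icc, sub_zero, ENNReal.ofReal_mul (by norm_num)]
          norm_num
          ring
  exact (ENNReal.mul_le_mul_iff_right (by simpa using by linarith) ENNReal.ofReal_ne_top).1 hkey

/-! ### Averaging over directions -/

/-- A polar-coordinates bound: integrals over `E` are controlled by an average, over directions in
an annulus, of weighted integrals along rays. -/
theorem lintegral_le_two_mul_lintegral_annulus {E : Type*} [NormedAddCommGroup E]
    [NormedSpace ℝ E] [MeasurableSpace E] [BorelSpace E] [FiniteDimensional ℝ E]
    (μ : Measure E)
    [μ.IsAddHaarMeasure] {n : ℕ} (hn : Module.finrank ℝ E = n + 1) {G : E → ℝ≥0∞}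
    (hG : Measurable G) :
    ∫⁻ h, G h ∂μ ≤ 2 * ∫⁻ θ in {θ : E | 1 ≤ ‖θ‖ ∧ ‖θ‖ ≤ 2},
      (∫⁻ r in Set.Ioi (0 : ℝ), ENNReal.ofReal (r ^ n) * G (r • θ)) ∂μ := by
  let A : Set E := {θ | 1 ≤ ‖θ‖ ∧ ‖θ‖ ≤ 2}
  have hA : MeasurableSet A :=
    (measurableSet_le measurable_const measurable_norm).inter
      (measurableSet_le measurable_norm measurable_const)
  let χ : E → ℝ≥0∞ := A.indicator 1
  have hχ : Measurable χ := measurable_one.indicator hA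
  have : Nontrivial E := Module.nontrivial_of_finrank_pos (R := ℝ) (by omega)
  -- For `h ≠ 0`, `r⁻¹ • h` lies in the annulus exactly when `‖h‖ / 2 ≤ r ≤ ‖h‖`, where `dr / r` has
  -- mass at least `1/2`.
  have h1 : ∀ᵐ h ∂μ, G h ≤ 2 * ∫⁻ r in Set.Ioi (0 : ℝ), ENNReal.ofReal r⁻¹ * (χ (r⁻¹ • h) * G h) := by
    filter_upwards [compl_mem_ae_iff.2 (measure_singleton (μ := μ) (0 : E))] with h hh
    have hh0 : 0 < ‖h‖ := norm_pos_iff.2 hh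
    calc G h = 2 * (∫⁻ r in Set.Icc (‖h‖ / 2) ‖h‖, ENNReal.ofReal ‖h‖⁻¹ * G h) := by
          rw [setLIntegral_const, Real.volume_Icc, mul_right_comm,
            ← ENNReal.ofReal_mul (by positivity),
            show ‖h‖⁻¹ * (‖h‖ - ‖h‖ / 2) = 2⁻¹ by field_simp; norm_num, ← mul_assoc,
            ENNReal.ofReal_inv_of_pos two_pos]
          simp [ENNReal.mul_inv_cancel]
      _ ≤ 2 * (∫⁻ r in Set.Icc (‖h‖ / 2) ‖h‖, ENNReal.ofReal r⁻¹ * (χ (r⁻¹ • h) * G h)) := by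
          gcongr 2 * ?_
          refine setLIntegral_mono' measurableSet_Icc fun r hr => ?_
          have hr0 : 0 < r := lt_of_lt_of_le (by positivity) hr.1
          have hmem : r⁻¹ • h ∈ A := by
            simp only [A, Set.mem_ofPred_eq, norm_smul, norm_inv, Real.norm_of_nonneg hr0.le]
            rw [← div_eq_inv_mul, le_div_iff₀ hr0, div_le_iff₀ hr0]
            exact ⟨by linarith [hr.2], by linarith [hr.1]⟩
          simp only [χ, Set.indicator_of_mem hmem, Pi.one_apply, one_mul]
          gcongr
          exact hr.2
      _ ≤ _ := by
          gcongr 2 * ?_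
          exact lintegral_mono_set fun r hr => lt_of_lt_of_le (by positivity) hr.1
  have h2 (r : ℝ) (hr : 0 < r) : ∫⁻ h, ENNReal.ofReal r⁻¹ * (χ (r⁻¹ • h) * G h) ∂μ
      = ∫⁻ θ, ENNReal.ofReal (r ^ n) * (χ θ * G (r • θ)) ∂μ := by
    have hm : Measurable fun h => χ (r⁻¹ • h) * G h := by fun_prop
    have hm' : Measurable fun θ => χ θ * G (r • θ) := by fun_prop
    rw [lintegral_const_mul _ hm, lintegral_const_mul _ hm']
    have h3 : ∫⁻ θ, χ θ * G (r • θ) ∂μ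
        = ENNReal.ofReal (r ^ (n + 1))⁻¹ * ∫⁻ h, χ (r⁻¹ • h) * G h ∂μ := by
      have := lintegral_map (μ := μ) hm (measurable_const_smul r)
      rw [Measure.map_addHaar_smul μ hr.ne', hn, lintegral_smul_measure,
        abs_of_pos (by positivity)] at this
      simp only [inv_smul_smul₀ hr.ne'] at this
      exact this.symm
    rw [h3, ← mul_assoc, ← ENNReal.ofReal_mul (by positivity)]
    congr 2
    field_simp
    ring
  have hm2 : Measurable fun z : ℝ × E => ENNReal.ofReal z.1⁻¹ * (χ (z.1⁻¹ • z.2) * G z.2) := by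
    fun_prop
  have hm3 : Measurable fun z : ℝ × E => ENNReal.ofReal (z.1 ^ n) * (χ z.2 * G (z.1 • z.2)) := by
    fun_prop
  calc ∫⁻ h, G h ∂μ
      ≤ ∫⁻ h, 2 * (∫⁻ r in Set.Ioi (0 : ℝ), ENNReal.ofReal r⁻¹ * (χ (r⁻¹ • h) * G h)) ∂μ :=
        lintegral_mono_ae h1
    _ = 2 * ∫⁻ r in Set.Ioi (0 : ℝ), ∫⁻ h, ENNReal.ofReal r⁻¹ * (χ (r⁻¹ • h) * G h) ∂μ := by
        rw [lintegral_const_mul _ hm2.lintegral_prod_left', lintegral_lintegral_swap]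
        exact (hm2.comp measurable_swap).aemeasurable
    _ = 2 * ∫⁻ r in Set.Ioi (0 : ℝ), ∫⁻ θ, ENNReal.ofReal (r ^ n) * (χ θ * G (r • θ)) ∂μ := by
        congr 1
        exact setLIntegral_congr_fun measurableSet_Ioi fun r hr => h2 r hr
    _ = 2 * ∫⁻ θ, (∫⁻ r in Set.Ioi (0 : ℝ), ENNReal.ofReal (r ^ n) * (χ θ * G (r • θ))) ∂μ := by
        rw [lintegral_lintegral_swap hm3.aemeasurable]
    _ = _ := by
        rw [← lintegral_indicator hA]
        congr 2 with θ
        by_cases hθ : θ ∈ A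
        · simp [χ, Set.indicator_of_mem hθ]
        · simp [χ, Set.indicator_of_notMem hθ]

/-- The weak-type `(1, 1)` estimate for the difference quotients `|u x - u y| / ‖x - y‖ ^ (d + 1)`,
where `d = n + 1` is the dimension. -/
theorem ofReal_mul_measure_prod_le {E : Type*} [NormedAddCommGroup E]
    [NormedSpace ℝ E] [MeasurableSpace E] [BorelSpace E] [FiniteDimensional ℝ E]
    (μ : Measure E) [μ.IsAddHaarMeasure]
    {n : ℕ} (hn : Module.finrank ℝ E = n + 1) {u : E → ℝ} (hu : ContDiff ℝ 1 u) {M : ℝ}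
    (hM : ∀ x, |u x| ≤ M) {t : ℝ} (ht : 0 < t) :
    ENNReal.ofReal t * (μ.prod μ) {z | t * ‖z.1 - z.2‖ ^ (n + 2) ≤ |u z.1 - u z.2|}
      ≤ 8 * 5 ^ (n + 2) * μ (Metric.closedBall 0 2) * ∫⁻ x, ‖fderiv ℝ u x‖ₑ ∂μ := by
  have hc := hu.continuous
  have : ProperSpace E := FiniteDimensional.proper_real E
  have : SecondCountableTopology E := inferInstance
  set S : Set (E × E) := {z | t * ‖z.1 - z.2‖ ^ (n + 2) ≤ |u z.1 - u z.2|}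
  have hS : MeasurableSet S :=
    (isClosed_le (f := fun z : E × E => t * ‖z.1 - z.2‖ ^ (n + 2))
      (g := fun z : E × E => |u z.1 - u z.2|) (by fun_prop) (by fun_prop)).measurableSet
  let T : Set (E × E) := {z | t * ‖z.1‖ ^ (n + 2) ≤ |u (z.2 + z.1) - u z.2|}
  have hT : MeasurableSet T :=
    (isClosed_le (f := fun z : E × E => t * ‖z.1‖ ^ (n + 2))
      (g := fun z : E × E => |u (z.2 + z.1) - u z.2|) (by fun_prop) (by fun_prop)).measurableSet
  let G : E → ℝ≥0∞ := fun h => μ (Prod.mk h ⁻¹' T)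
  have hG : Measurable G := measurable_measure_prodMk_left hT
  -- A measure-preserving shear replaces pairs of points by a point and a displacement `h`.
  have hST : (μ.prod μ) S = ∫⁻ h, G h ∂μ := by
    rw [← Measure.prod_apply hT,
      ← (measurePreserving_prod_add_swap_right μ μ).measure_preimage hS.nullMeasurableSet]
    congr 1
    ext z
    simp only [S, T, Set.mem_preimage, Set.mem_ofPred_eq]
    rw [abs_sub_comm, norm_sub_rev, add_comm z.1 z.2, add_sub_cancel_left]
  let D : ℝ≥0∞ := ∫⁻ x, ‖fderiv ℝ u x‖ₑ ∂μ
  let A : Set E := {θ | 1 ≤ ‖θ‖ ∧ ‖θ‖ ≤ 2}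
  have hA : MeasurableSet A :=
    (measurableSet_le measurable_const measurable_norm).inter
      (measurableSet_le measurable_norm measurable_const)
  -- `1 ≤ ‖θ‖` allows `‖r • θ‖` to be replaced by `r`; `‖θ‖ ≤ 2` bounds the factor `‖θ‖ₑ`.
  have hray (θ : E) (hθ : θ ∈ A) : ENNReal.ofReal t *
      ∫⁻ r in Set.Ioi (0 : ℝ), ENNReal.ofReal (r ^ n) * G (r • θ) ≤ 4 * 5 ^ (n + 2) * D := by
    calc _ ≤ ENNReal.ofReal t * ∫⁻ r in Set.Ioi (0 : ℝ), ENNReal.ofReal (r ^ n) *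
            μ {x | t * r ^ (n + 2) ≤ |u (x + r • θ) - u x|} := by
          gcongr ENNReal.ofReal t * ?_
          refine setLIntegral_mono' measurableSet_Ioi fun r (hr : 0 < r) => ?_
          gcongr
          refine measure_mono fun x hx => ?_
          refine le_trans ?_ (show t * ‖r • θ‖ ^ (n + 2) ≤ |u (x + r • θ) - u x| from hx)
          gcongr
          rw [norm_smul, Real.norm_of_nonneg hr.le]
          exact le_mul_of_one_le_right hr.le hθ.1
      _ ≤ 2 * 5 ^ (n + 2) * ‖θ‖ₑ * D := lintegral_measure_direction_le μ hu hM θ ht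
      _ ≤ 2 * 5 ^ (n + 2) * 2 * D := by
          gcongr
          rw [← ofReal_norm]
          simpa using ENNReal.ofReal_le_ofReal hθ.2
      _ = _ := by ring
  calc ENNReal.ofReal t * (μ.prod μ) S
      ≤ ENNReal.ofReal t * (2 * ∫⁻ θ in A,
          (∫⁻ r in Set.Ioi (0 : ℝ), ENNReal.ofReal (r ^ n) * G (r • θ)) ∂μ) := by
        rw [hST]
        gcongr
        exact lintegral_le_two_mul_lintegral_annulus μ hn hG
    _ = 2 * ∫⁻ θ in A, ENNReal.ofReal t *
          (∫⁻ r in Set.Ioi (0 : ℝ), ENNReal.ofReal (r ^ n) * G (r • θ)) ∂μ := by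
        rw [lintegral_const_mul' _ _ ENNReal.ofReal_ne_top]; ring
    _ ≤ 2 * ∫⁻ _ in A, 4 * 5 ^ (n + 2) * D ∂μ := by
        gcongr 2 * ?_
        exact setLIntegral_mono' hA hray
    _ = 8 * 5 ^ (n + 2) * μ A * D := by
        rw [setLIntegral_const]; ring
    _ ≤ _ := by
        gcongr
        exact fun θ hθ => mem_closedBall_zero_iff.2 hθ.2

/-! ### Interpolation and conclusion -/

/-- A continuous function is bounded pointwise by its `L^∞` norm. -/
theorem Continuous.enorm_le_eLpNorm_top {X : Type*} [TopologicalSpace X] [MeasurableSpace X]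
    {μ : Measure X} [μ.IsOpenPosMeasure] {u : X → ℝ} (hu : Continuous u) (x : X) :
    ‖u x‖ₑ ≤ eLpNorm u ∞ μ := by
  have hopen : IsOpen {y | eLpNormEssSup u μ < ‖u y‖ₑ} := isOpen_lt continuous_const hu.enorm
  have h := hopen.measure_eq_zero_iff (μ := μ) |>.1 meas_eLpNormEssSup_lt
  rw [eLpNorm_exponent_top]
  by_contra! hx
  exact (h ▸ hx : x ∈ (∅ : Set X))

/-- Interpolation between the trivial `L^∞` bound and an estimate with exponent `1`. -/
theorem rpow_div_mul_le_of_le_abs_div_rpow {a d t M p k : ℝ} (hd : 0 ≤ d) (ht : 0 < t) (hM : 0 < M)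
    (hp : 1 ≤ p) (hk : 0 < k) (ha : |a| ≤ M) (h : t ≤ |a / d ^ (k / p)|) :
    t ^ p / M ^ (p - 1) * d ^ k ≤ |a| := by
  have hp0 : 0 < p := by linarith
  rcases hd.eq_or_lt with rfl | hd
  · simp [Real.zero_rpow hk.ne']
  have hdk : 0 < d ^ (k / p) := Real.rpow_pos_of_pos hd _
  rw [abs_div, abs_of_pos hdk, le_div_iff₀ hdk] at h
  have hMp : 0 < M ^ (p - 1) := Real.rpow_pos_of_pos hM _
  rw [div_mul_eq_mul_div, div_le_iff₀ hMp]
  have ha0 : 0 < |a| := lt_of_lt_of_le (by positivity) h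
  calc t ^ p * d ^ k = (t * d ^ (k / p)) ^ p := by
        rw [Real.mul_rpow ht.le hdk.le, ← Real.rpow_mul hd.le, div_mul_cancel₀ _ hp0.ne']
    _ ≤ |a| ^ p := Real.rpow_le_rpow (by positivity) h hp0.le
    _ = |a| * |a| ^ (p - 1) := by
        rw [Real.rpow_sub_one ha0.ne', mul_div_cancel₀ _ ha0.ne']
    _ ≤ |a| * M ^ (p - 1) := by
        gcongr

theorem theorem4 (N : ℕ) (hN : 1 ≤ N) :
    ∃ C : ℝ≥0, ∀ p : ℝ, 1 ≤ p →
      ∀ u : EuclideanSpace ℝ (Fin N) → ℝ, ContDiff ℝ (⊤ : ℕ∞) u → HasCompactSupport u →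
        marcinkiewiczQuasinorm
            (fun z : EuclideanSpace ℝ (Fin N) × EuclideanSpace ℝ (Fin N) =>
              (u z.1 - u z.2) / ‖z.1 - z.2‖ ^ (((N : ℝ) + 1) / p))
            p (volume.prod volume)
          ≤ (C : ℝ≥0∞) * eLpNorm u ∞ volume ^ (1 - 1 / p)
              * eLpNorm (fun x => gradient u x) 1 volume ^ (1 / p) := by
  obtain ⟨n, rfl⟩ : ∃ n, N = n + 1 := ⟨N - 1, by omega⟩
  let V := EuclideanSpace ℝ (Fin (n + 1))
  let K : ℝ≥0∞ := 8 * 5 ^ (n + 2) * volume (Metric.closedBall (0 : V) 2)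
  have hK : K ≠ ∞ := ENNReal.mul_ne_top (by finiteness) measure_closedBall_lt_top.ne
  -- The argument yields `2 ^ (1 - 1 / p) * K ^ (1 / p)`; using `1 + K ≥ 1` makes the bound uniform
  -- in `p`.
  refine ⟨(2 * (1 + K)).toNNReal, fun p hp u hu hsupp => ?_⟩
  rw [ENNReal.coe_toNNReal (by finiteness)]
  have hp0 : 0 < p := by linarith
  have hu1 : ContDiff ℝ 1 u := hu.of_le (by exact_mod_cast le_top)
  have hgrad : eLpNorm (fun x => gradient u x) 1 volume = ∫⁻ x, ‖fderiv ℝ u x‖ₑ := by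
    rw [eLpNorm_one_eq_lintegral_enorm]
    simp only [gradient, LinearIsometryEquiv.enorm_map]
  rw [hgrad]
  set D : ℝ≥0∞ := ∫⁻ x, ‖fderiv ℝ u x‖ₑ
  have htop : eLpNorm u ∞ (volume : Measure V) ≠ ∞ :=
    (hu.continuous.memLp_of_hasCompactSupport hsupp).eLpNorm_ne_top
  obtain ⟨m, hm⟩ : ∃ m : ℝ≥0, eLpNorm u ∞ (volume : Measure V) = m :=
    ⟨_, (ENNReal.coe_toNNReal htop).symm⟩
  have hum (x : V) : |u x| ≤ m := by
    have := hu.continuous.enorm_le_eLpNorm_top (μ := volume) x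
    rw [hm] at this
    exact_mod_cast this
  rw [hm]
  have hsup : ∀ t : ℝ, 0 < t → ENNReal.ofReal (t ^ p) * (volume.prod volume)
      {z : V × V | t ≤ |(u z.1 - u z.2) / ‖z.1 - z.2‖ ^ ((((n + 1 : ℕ) : ℝ) + 1) / p)|}
        ≤ (2 * m : ℝ≥0∞) ^ (p - 1) * (K * D) := by
    intro t ht
    -- The rescaled level divides by a power of `2 * m`, so `u = 0` is treated apart: its superlevel
    -- sets are empty.
    rcases eq_or_ne m 0 with rfl | hm0
    · have hu0 : ∀ x, u x = 0 := fun x => by simpa using hum x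
      simp [hu0, ht.not_ge]
    have hm0 : (0 : ℝ) < 2 * m := by positivity
    have hmp : 0 < (2 * m : ℝ) ^ (p - 1) := Real.rpow_pos_of_pos hm0 _
    have hs : 0 < t ^ p / (2 * m : ℝ) ^ (p - 1) := by positivity
    calc _ ≤ ENNReal.ofReal (t ^ p) * (volume.prod volume) {z : V × V |
            t ^ p / (2 * m : ℝ) ^ (p - 1) * ‖z.1 - z.2‖ ^ (n + 2) ≤ |u z.1 - u z.2|} := by
          gcongr ENNReal.ofReal (t ^ p) * ?_
          refine measure_mono fun z (hz : t ≤ _) => ?_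
          have ha : |u z.1 - u z.2| ≤ 2 * m := by
            linarith [abs_sub (u z.1) (u z.2), hum z.1, hum z.2]
          have := rpow_div_mul_le_of_le_abs_div_rpow (norm_nonneg _) ht hm0 hp (by positivity) ha hz
          rwa [show ((n + 1 : ℕ) : ℝ) + 1 = ((n + 2 : ℕ) : ℝ) by push_cast; ring,
            Real.rpow_natCast] at this
      _ = (2 * m : ℝ≥0∞) ^ (p - 1) * (ENNReal.ofReal (t ^ p / (2 * m : ℝ) ^ (p - 1)) *
            (volume.prod volume) {z : V × V |
            t ^ p / (2 * m : ℝ) ^ (p - 1) * ‖z.1 - z.2‖ ^ (n + 2) ≤ |u z.1 - u z.2|}) := by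
          rw [← mul_assoc]
          congr 1
          have : (2 * m : ℝ≥0∞) = ENNReal.ofReal (2 * m) := by
            rw [ENNReal.ofReal_mul two_pos.le]; simp
          rw [this, ENNReal.ofReal_rpow_of_pos hm0, ← ENNReal.ofReal_mul hmp.le]
          congr 1
          field_simp
      _ ≤ _ := by
          gcongr (2 * m : ℝ≥0∞) ^ (p - 1) * ?_
          exact ofReal_mul_measure_prod_le volume finrank_euclideanSpace_fin hu1 hum hs
  calc _ ≤ ((2 * m : ℝ≥0∞) ^ (p - 1) * (K * D)) ^ (1 / p) :=
        ENNReal.rpow_le_rpow (iSup₂_le hsup) (by positivity)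
    _ = (2 ^ (1 - 1 / p) * K ^ (1 / p)) * (m : ℝ≥0∞) ^ (1 - 1 / p) * D ^ (1 / p) := by
        have h1 : 0 ≤ 1 / p := by positivity
        have h2 : 0 ≤ 1 - 1 / p := by
          rw [sub_nonneg, div_le_one hp0]; exact hp
        rw [ENNReal.mul_rpow_of_nonneg _ _ h1, ENNReal.mul_rpow_of_nonneg _ _ h1,
          ← ENNReal.rpow_mul, show (p - 1) * (1 / p) = 1 - 1 / p by field_simp,
          ENNReal.mul_rpow_of_nonneg _ _ h2]
        ring
    _ ≤ _ := by
        have h1 : 0 ≤ 1 / p := by positivity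
        have h3 : 1 / p ≤ 1 := by rw [div_le_one hp0]; exact hp
        gcongr
        · calc (2 : ℝ≥0∞) ^ (1 - 1 / p) ≤ 2 ^ (1 : ℝ) :=
              ENNReal.rpow_le_rpow_of_exponent_le (by norm_num) (by linarith)
            _ = 2 := ENNReal.rpow_one 2
        · calc K ^ (1 / p) ≤ (1 + K) ^ (1 / p) := by gcongr; exact le_add_self
            _ ≤ (1 + K) ^ (1 : ℝ) := ENNReal.rpow_le_rpow_of_exponent_le le_self_add h3
            _ = 1 + K := ENNReal.rpow_one _
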